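/- Call a group $G$ a CA-group if the centralizer of every non-trivial element of $G$ is abelian, and a CSA-group if moreover the centralizer $C$ of every element of $G$ is malnormal, i.e. $C \cap hCh^{-1} = \{1\}$ for all $h \in G \smallsetminus C$. Let $p$ and $\ell$ be primes, let $K$ be a finite extension of $\mathbb{Q}_p$ with ramification index $e$, and let $D$ be a central division algebra of degree $\ell$ over $K$ (so $\dim_K D = \ell^2$). Let $R$ be the ring of integers of $D$ and let $\pi$ be a generator of the maximal ideal of $R$. Let $\mathrm{SL}_1(D)$ be the group of elements of $D^\times$ of reduced norm $1$, and for $n \ge 1$ let $\mathrm{SL}_1^n(D) = \{ g \in \mathrm{SL}_1(D) \mid g \equiv 1 \pmod{\pi^n R} \}$. Then: 1. $\mathrm{SL}_1(D)$ is CA if and only if $K$ contains no non-trivial $\ell$-th root of unity. In this case, $\mathrm{SL}_1(D)$ is CSA. 2. $\mathrm{SL}_1^1(D)$ is CA if and only if either $p \neq \ell$, or $p = \ell$ and $K$ contains no non-trivial $\ell$-th root of unity. 3. If $n \geq e\ell/(p-1)$, and if this inequality is strict in case $p = \ell$ and $K$ contains a non-trivial $\ell$-th root of unity, then $\mathrm{SL}_1^n(D)$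 is CA. -/

import Mathlib

open scoped TensorProduct

/-! ### Group theory -/

/-- A CA-group: the centralizer of every non-trivial element is abelian. -/
def IsCA (G : Type*) [Group G] : Prop :=
  ∀ g : G, g ≠ 1 → ∀ x ∈ Subgroup.centralizer {g}, ∀ y ∈ Subgroup.centralizer {g}, x * y = y * x

/-- A subgroup `H` of `G` is malnormal if every conjugate of `H` by an element outside of `H`
intersects `H` trivially. -/
def IsMalnormal {G : Type*} [Group G] (H : Subgroup G) : Prop :=
  ∀ h : G, h ∉ H → ∀ x ∈ H, h * x * h⁻¹ ∈ H → x = 1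

/-- A CSA-group: a CA-group in which every centralizer of an element is malnormal. -/
def IsCSA (G : Type*) [Group G] : Prop :=
  IsCA G ∧ ∀ g : G, IsMalnormal (Subgroup.centralizer {g})

/-! ### The ring of integers of a division algebra over `ℚ_[p]` -/

theorem norm_le_one_of_isIntegral_padic (p : ℕ) [Fact p.Prime] {x : ℚ_[p]}
    (h : IsIntegral (PadicInt.subring p) x) : ‖x‖ ≤ 1 := by
  have h' : IsIntegral ℤ_[p] x := h
  obtain ⟨y, hy⟩ := IsIntegrallyClosed.isIntegral_iff.1 h'
  rw [← hy]
  exact y.2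

theorem isIntegral_iff_norm_norm_le_one_field (p : ℕ) [Fact p.Prime] (F : Type*) [Field F] [Algebra ℚ_[p] F]
    [FiniteDimensional ℚ_[p] F] (y : F) :
    IsIntegral (PadicInt.subring p) y ↔ ‖Algebra.norm ℚ_[p] y‖ ≤ 1 := by
  constructor
  · intro h
    exact norm_le_one_of_isIntegral_padic p (Algebra.isIntegral_norm ℚ_[p] h)
  · intro h
    have hint : IsIntegral ℚ_[p] y := Algebra.IsIntegral.isIntegral y
    rw [Algebra.norm_eq_norm_adjoin, norm_pow,
      pow_le_one_iff_of_nonneg (norm_nonneg _) Module.finrank_pos.ne',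
      ← IntermediateField.adjoin.powerBasis_gen hint,
      Algebra.PowerBasis.norm_gen_eq_coeff_zero_minpoly, norm_mul, norm_pow, norm_neg, norm_one,
      one_pow, one_mul, IntermediateField.adjoin.powerBasis_gen hint,
      IntermediateField.minpoly_gen] at h
    have hs : spectralNorm ℚ_[p] F y ≤ 1 := by
      rw [spectralNorm.spectralNorm_eq_norm_coeff_zero_rpow]
      exact Real.rpow_le_one (norm_nonneg _) h (by positivity)
    rw [spectralNorm, spectralValue_le_one_iff (minpoly.monic hint)] at hs
    have hc : (↑(minpoly ℚ_[p] y).coeffs : Set ℚ_[p]) ⊆ PadicInt.subring p := by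
      intro c hc
      obtain ⟨n, -, rfl⟩ := Polynomial.mem_coeffs_iff.1 hc
      exact hs n
    refine ⟨(minpoly ℚ_[p] y).toSubring _ hc, ?_, ?_⟩
    · exact (Polynomial.monic_toSubring _ _ _).2 (minpoly.monic hint)
    · have := minpoly.aeval ℚ_[p] y
      rw [← Polynomial.map_toSubring _ (PadicInt.subring p) hc] at this
      rw [Polynomial.aeval_def, Polynomial.eval₂_map] at this
      exact this

theorem norm_algHom_eq_pow (p : ℕ) [Fact p.Prime] {F D : Type*} [Field F] [Algebra ℚ_[p] F] [DivisionRing D]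
    [Algebra ℚ_[p] D] [FiniteDimensional ℚ_[p] D] (f : F →ₐ[ℚ_[p]] D) :
    ∃ k : ℕ, k ≠ 0 ∧ ∀ y : F, Algebra.norm ℚ_[p] (f y) = Algebra.norm ℚ_[p] y ^ k := by
  let _ : Module F D := Module.compHom D f.toRingHom
  have : IsScalarTower ℚ_[p] F D := ⟨fun a b d => by
    change f (a • b) * d = a • (f b * d)
    rw [map_smul, smul_mul_assoc]⟩
  have : Module.Finite F D := Module.Finite.of_restrictScalars_finite ℚ_[p] F D
  refine ⟨Module.finrank F D, Module.finrank_pos.ne', fun y => ?_⟩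
  have h : Algebra.lmul ℚ_[p] D (f y)
      = ((y • LinearMap.id : D →ₗ[F] D).restrictScalars ℚ_[p]) := by
    ext d
    rfl
  rw [Algebra.norm_apply, h, LinearMap.det_restrictScalars, LinearMap.det_smul, LinearMap.det_id,
    mul_one, map_pow]

theorem exists_field_algHom (p : ℕ) [Fact p.Prime] {D : Type*} [DivisionRing D] [Algebra ℚ_[p] D]
    [FiniteDimensional ℚ_[p] D] (x : D) :
    ∃ (F : Type) (_ : Field F) (_ : Algebra ℚ_[p] F) (_ : FiniteDimensional ℚ_[p] F)
      (f : F →ₐ[ℚ_[p]] D) (y : F), f y = x := by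
  have hint : IsIntegral ℚ_[p] x := Algebra.IsIntegral.isIntegral x
  have : Fact (Irreducible (minpoly ℚ_[p] x)) := ⟨minpoly.irreducible hint⟩
  let f : AdjoinRoot (minpoly ℚ_[p] x) →ₐ[ℚ_[p]] D :=
    Ideal.Quotient.liftₐ (Ideal.span {minpoly ℚ_[p] x}) (Polynomial.aeval x) (by
      intro a ha
      obtain ⟨b, rfl⟩ := Ideal.mem_span_singleton.1 ha
      rw [map_mul, minpoly.aeval, zero_mul])
  refine ⟨AdjoinRoot (minpoly ℚ_[p] x), inferInstance, inferInstance,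
    (AdjoinRoot.powerBasis (minpoly.ne_zero hint)).finite, f, AdjoinRoot.root _, ?_⟩
  change Polynomial.aeval x Polynomial.X = x
  simp

theorem isIntegral_iff_norm_norm_le_one (p : ℕ) [Fact p.Prime] {D : Type*} [DivisionRing D] [Algebra ℚ_[p] D]
    [FiniteDimensional ℚ_[p] D] (x : D) :
    IsIntegral (PadicInt.subring p) x ↔ ‖Algebra.norm ℚ_[p] x‖ ≤ 1 := by
  obtain ⟨F, _, _, _, f, y, rfl⟩ := exists_field_algHom p x
  obtain ⟨k, hk, hf⟩ := norm_algHom_eq_pow p f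
  rw [hf, norm_pow, pow_le_one_iff_of_nonneg (norm_nonneg _) hk,
    ← isIntegral_iff_norm_norm_le_one_field]
  exact isIntegral_algHom_iff (f.restrictScalars (PadicInt.subring p)) f.toRingHom.injective

/-- The ring of integers `R` of a division algebra `D` of finite dimension over `ℚ_[p]`: the
elements of `D` that are integral over the ring of `p`-adic integers. -/
def ringOfIntegers (p : ℕ) [Fact p.Prime] (D : Type*) [DivisionRing D] [Algebra ℚ_[p] D]
    [FiniteDimensional ℚ_[p] D] :
    Subring D where
  carrier := {x | IsIntegral (PadicInt.subring p) x}
  one_mem' := isIntegral_one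
  zero_mem' := isIntegral_zero
  neg_mem' := fun h => h.neg
  mul_mem' := by
    intro x y hx hy
    rw [Set.mem_ofPred_eq, isIntegral_iff_norm_norm_le_one] at *
    rw [map_mul, norm_mul]
    exact mul_le_one₀ hx (norm_nonneg _) hy
  add_mem' := by
    have key : ∀ x y : D, y ≠ 0 → IsIntegral (PadicInt.subring p) y →
        ‖Algebra.norm ℚ_[p] x‖ ≤ ‖Algebra.norm ℚ_[p] y‖ →
        IsIntegral (PadicInt.subring p) (x + y) := by
      intro x y hy0 hy hxy
      have hNy : 0 < ‖Algebra.norm ℚ_[p] y‖ :=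
        norm_pos_iff.2 ((isUnit_iff_ne_zero.2 hy0).map (Algebra.norm ℚ_[p])).ne_zero
      have hz : IsIntegral (PadicInt.subring p) (x * y⁻¹) := by
        rw [isIntegral_iff_norm_norm_le_one]
        have : ‖Algebra.norm ℚ_[p] (x * y⁻¹)‖ * ‖Algebra.norm ℚ_[p] y‖
            = ‖Algebra.norm ℚ_[p] x‖ := by
          rw [← norm_mul, ← map_mul, inv_mul_cancel_right₀ hy0]
        by_contra! h
        nlinarith
      have h1 : IsIntegral (PadicInt.subring p) (x * y⁻¹ + 1) := by
        obtain ⟨F, _, _, _, f, w, hw⟩ := exists_field_algHom p (x * y⁻¹)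
        have hf := fun u : F => isIntegral_algHom_iff
          (f.restrictScalars (PadicInt.subring p)) f.toRingHom.injective (x := u)
        rw [← hw] at hz ⊢
        have := (hf (w + 1)).2 (((hf w).1 hz).add isIntegral_one)
        simpa using this
      rw [isIntegral_iff_norm_norm_le_one] at *
      have : x + y = (x * y⁻¹ + 1) * y := by
        rw [add_mul, inv_mul_cancel_right₀ hy0, one_mul]
      rw [this, map_mul, norm_mul]
      exact mul_le_one₀ h1 (norm_nonneg _) hy
    intro x y hx hy
    rcases eq_or_ne y 0 with rfl | hy0
    · simpa using hx
    rcases eq_or_ne x 0 with rfl | hx0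
    · simpa using hy
    rcases le_total ‖Algebra.norm ℚ_[p] x‖ ‖Algebra.norm ℚ_[p] y‖ with h | h
    · exact key x y hy0 hy h
    · rw [add_comm]
      exact key y x hx0 hx h

/-- An element `π` of the ring of integers `R` of `D` which generates the maximal ideal of `R`.
(The ring `R` is local, so its only maximal left ideal is the maximal ideal.) -/
def GeneratesMaximalIdeal (p : ℕ) [Fact p.Prime] {D : Type*} [DivisionRing D] [Algebra ℚ_[p] D]
    [FiniteDimensional ℚ_[p] D] (π : ringOfIntegers p D) : Prop :=
  (Ideal.span {π}).IsMaximal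

/-- The ramification index over `ℚ_[p]` of a finite extension `K` of `ℚ_[p]`: the ramification index
over `p` of the prime of the integral closure of the ring of `p`-adic integers in `K`. -/
noncomputable def ramificationIndex (p : ℕ) [Fact p.Prime] (K : Type*) [Field K]
    [Algebra ℚ_[p] K] : ℕ :=
  (Ideal.span {(p : PadicInt.subring p)}).ramificationIdxIn
    (integralClosure (PadicInt.subring p) K)

/-! ### The reduced norm -/

theorem isSimpleRing_tensorProduct_field (K D L : Type*) [Field K] [DivisionRing D] [Algebra K D]
    [Algebra.IsCentral K D] [Field L] [Algebra K L] : IsSimpleRing (L ⊗[K] D) := by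
  suffices h : IsSimpleRing (D ⊗[K] L) from
    IsSimpleRing.of_ringEquiv (Algebra.TensorProduct.comm K D L).toRingEquiv h
  refine IsSimpleRing.of_eq_bot_or_eq_top fun I => ?_
  rw [or_iff_not_imp_left, ← I.one_mem_iff]
  intro hI
  obtain ⟨x₀, hx₀, hx₀' : x₀ ≠ 0⟩ :=
    SetLike.exists_of_lt (bot_lt_iff_ne_bot.mpr hI : ⊥ < I)
  let b := Module.Basis.ofVectorSpace K L
  let B := Algebra.TensorProduct.basis D b
  have hl : ∀ (d : D) (x : D ⊗[K] L) j, B.repr (d ⊗ₜ 1 * x) j = d * B.repr x j := by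
    intro d x j
    induction x with
    | zero => simp
    | add x y hx hy => simp [mul_add, hx, hy]
    | tmul a l => simp [B, Algebra.TensorProduct.basis_repr_tmul, mul_assoc]
  have hr : ∀ (d : D) (x : D ⊗[K] L) j, B.repr (x * d ⊗ₜ 1) j = B.repr x j * d := by
    intro d x j
    induction x with
    | zero => simp
    | add x y hx hy => simp [add_mul, hx, hy]
    | tmul a l => simp [B, Algebra.TensorProduct.basis_repr_tmul, mul_assoc,  Algebra.commutes]
  have key : ∀ n : ℕ, ∀ x ∈ I, x ≠ 0 → (B.repr x).support.card = n → (1 : D ⊗[K] L) ∈ I := by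
    intro n
    induction n using Nat.strong_induction_on with
    | _ n ih =>
      intro x hxI hx0 hn
      obtain ⟨j₀, hj₀⟩ : ∃ j, B.repr x j ≠ 0 := by
        by_contra! h
        exact hx0 (B.repr.map_eq_zero_iff.1 (Finsupp.ext h))
      set c := B.repr x j₀ with hc
      set y := (c⁻¹ ⊗ₜ[K] (1 : L)) * x with hy
      have hyI : y ∈ I := I.mul_mem_left _ _ hxI
      have hyj : ∀ j, B.repr y j = c⁻¹ * B.repr x j := hl _ _
      have hy1 : B.repr y j₀ = 1 := by rw [hyj, inv_mul_cancel₀ hj₀]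
      have hy0 : y ≠ 0 := by
        intro h
        rw [h] at hy1
        simp at hy1
      by_cases hcen : ∀ d : D, (d ⊗ₜ[K] (1 : L)) * y - y * (d ⊗ₜ 1) = 0
      · have hK : ∀ j, ∃ a : K, algebraMap K D a = B.repr y j := by
          intro j
          have : B.repr y j ∈ Subalgebra.center K D := by
            rw [Subalgebra.mem_center_iff]
            intro d
            rw [← hl, ← hr, sub_eq_zero.1 (hcen d)]
          exact Algebra.IsCentral.mem_center_iff K |>.1 this |>.imp fun a h => h.symm
        choose a ha using hK
        have hyl : y = 1 ⊗ₜ[K] (∑ j ∈ (B.repr y).support, a j • b j) := by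
          conv_lhs => rw [← B.linearCombination_repr y]
          rw [Finsupp.linearCombination_apply, Finsupp.sum, TensorProduct.tmul_sum]
          refine Finset.sum_congr rfl fun j _ => ?_
          rw [← ha j, TensorProduct.tmul_smul]
          simp [B]
        set l := ∑ j ∈ (B.repr y).support, a j • b j with hl'
        have hl0 : l ≠ 0 := by
          intro h
          rw [h, TensorProduct.tmul_zero] at hyl
          exact hy0 hyl
        have : (1 : D ⊗[K] L) = (1 ⊗ₜ[K] l⁻¹) * y := by
          rw [hyl, Algebra.TensorProduct.tmul_mul_tmul, inv_mul_cancel₀ hl0, one_mul,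
            Algebra.TensorProduct.one_def]
        rw [this]
        exact I.mul_mem_left _ _ hyI
      · push Not at hcen
        obtain ⟨d, hd⟩ := hcen
        refine ih _ ?_ _ (I.sub_mem (I.mul_mem_left _ _ hyI) (I.mul_mem_right _ _ hyI)) hd rfl
        rw [← hn]
        refine Finset.card_lt_card (Finset.ssubset_iff_of_subset ?_ |>.2 ⟨j₀, ?_, ?_⟩)
        · intro j hj
          rw [Finsupp.mem_support_iff] at *
          intro h
          apply hj
          rw [map_sub, Finsupp.sub_apply, hl, hr, hyj, h]
          simp
        · exact Finsupp.mem_support_iff.2 hj₀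
        · rw [Finsupp.notMem_support_iff, map_sub, Finsupp.sub_apply, hl, hr, hy1]
          simp
  exact key _ x₀ hx₀ hx₀' rfl

theorem exists_splitting (K D : Type*) [Field K] [DivisionRing D] [Algebra K D]
    [Algebra.IsCentral K D] [FiniteDimensional K D] :
    ∃ n : ℕ, Nonempty (AlgebraicClosure K ⊗[K] D ≃ₐ[AlgebraicClosure K]
      Matrix (Fin n) (Fin n) (AlgebraicClosure K)) := by
  have := isSimpleRing_tensorProduct_field K D (AlgebraicClosure K)
  obtain ⟨n, -, h⟩ := IsSimpleRing.exists_algEquiv_matrix_of_isAlgClosed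
    (AlgebraicClosure K) (AlgebraicClosure K ⊗[K] D)
  exact ⟨n, h⟩

/-- The reduced norm of a central division algebra `D` over `K`, namely `x ↦ det (φ (1 ⊗ x))` for an
isomorphism `φ` of the scalar extension of `D` to an algebraic closure of `K` with a matrix algebra;
by Skolem-Noether it does not depend on `φ`. Its values lie in the subfield `K` of the algebraic
closure. -/
noncomputable def reducedNorm (K D : Type*) [Field K] [DivisionRing D] [Algebra K D]
    [Algebra.IsCentral K D] [FiniteDimensional K D] : D →* AlgebraicClosure K :=
  Matrix.detMonoidHom.comp
    ((exists_splitting K D).choose_spec.some.toRingEquiv.toMonoidHom.comp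
      (Algebra.TensorProduct.includeRight : D →ₐ[K] AlgebraicClosure K ⊗[K] D).toMonoidHom)

theorem exists_reducedNorm_eq_det (K D : Type*) [Field K] [DivisionRing D] [Algebra K D]
    [Algebra.IsCentral K D] [FiniteDimensional K D] :
    ∃ (n : ℕ) (φ : AlgebraicClosure K ⊗[K] D ≃ₐ[AlgebraicClosure K]
      Matrix (Fin n) (Fin n) (AlgebraicClosure K)),
      ∀ x : D, reducedNorm K D x = (φ (1 ⊗ₜ[K] x)).det :=
  ⟨_, _, fun _ => rfl⟩

theorem norm_matrix_eq_det_pow {F : Type*} [Field F] {n : ℕ} (A : Matrix (Fin n) (Fin n) F) :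
    Algebra.norm F A = A.det ^ n := by
  have h : LinearMap.toMatrix (Matrix.stdBasis F (Fin n) (Fin n))
      (Matrix.stdBasis F (Fin n) (Fin n)) (Algebra.lmul F _ A)
      = Matrix.kroneckerMap (· * ·) A (1 : Matrix (Fin n) (Fin n) F) := by
    ext ⟨i, j⟩ ⟨k, l⟩
    rw [LinearMap.toMatrix_apply, Matrix.stdBasis_eq_single]
    have : ∀ M : Matrix (Fin n) (Fin n) F,
        (Matrix.stdBasis F (Fin n) (Fin n)).repr M (i, j) = M i j := fun M => rfl
    rw [this]
    by_cases hjl : j = l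
    · subst hjl
      simp
    · simp [hjl]
  rw [Algebra.norm_apply, ← LinearMap.det_toMatrix (Matrix.stdBasis F (Fin n) (Fin n)), h,
    Matrix.det_kronecker]
  simp

theorem norm_eq_one_of_reducedNorm_eq_one {K D : Type*} [Field K] [DivisionRing D] [Algebra K D]
    [Algebra.IsCentral K D] [FiniteDimensional K D] {x : D} (hx : reducedNorm K D x = 1) :
    Algebra.norm K x = 1 := by
  obtain ⟨n, φ, hφ⟩ := exists_reducedNorm_eq_det K D
  rw [hφ] at hx
  apply (algebraMap K (AlgebraicClosure K)).injective
  rw [map_one, Algebra.norm_apply, ← LinearMap.det_baseChange]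
  have h1 : (Algebra.lmul K D x).baseChange (AlgebraicClosure K)
      = φ.symm.toLinearEquiv.toLinearMap ∘ₗ Algebra.lmul (AlgebraicClosure K) _ (φ (1 ⊗ₜ x)) ∘ₗ
        φ.symm.toLinearEquiv.symm.toLinearMap := by
    ext d
    simp
  rw [h1, LinearMap.det_conj, ← Algebra.norm_apply, norm_matrix_eq_det_pow, hx, one_pow]

/-! ### The group `SL_1(D)` and its congruence subgroups -/

/-- The group `SL_1(D)` of elements of reduced norm `1`. -/
noncomputable def SL1 (K D : Type*) [Field K] [DivisionRing D] [Algebra K D]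
    [Algebra.IsCentral K D] [FiniteDimensional K D] : Subgroup Dˣ :=
  ((reducedNorm K D).comp (Units.coeHom D)).ker

theorem mem_ringOfIntegers_of_mem_SL1 (p : ℕ) [Fact p.Prime] {K D : Type*} [Field K]
    [Algebra ℚ_[p] K] [DivisionRing D] [Algebra ℚ_[p] D] [Algebra K D] [IsScalarTower ℚ_[p] K D]
    [FiniteDimensional ℚ_[p] D] [Algebra.IsCentral K D] [FiniteDimensional K D] {g : Dˣ}
    (hg : g ∈ SL1 K D) : (g : D) ∈ ringOfIntegers p D := by
  change IsIntegral (PadicInt.subring p) (g : D)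
  rw [isIntegral_iff_norm_norm_le_one, ← Algebra.norm_norm (S := K),
    norm_eq_one_of_reducedNorm_eq_one (x := (g : D)) hg, map_one, norm_one]

/-- The congruence subgroup `SL_1^n(D) = {g ∈ SL_1(D) | g ≡ 1 mod π ^ n R}`, where `R` is the ring of
integers of `D`. -/
noncomputable def SL1Congruence (p : ℕ) [Fact p.Prime] (K : Type*) {D : Type*} [Field K]
    [Algebra ℚ_[p] K] [DivisionRing D] [Algebra ℚ_[p] D] [Algebra K D] [IsScalarTower ℚ_[p] K D]
    [FiniteDimensional ℚ_[p] D] [Algebra.IsCentral K D] [FiniteDimensional K D]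
    (π : ringOfIntegers p D) (n : ℕ) : Subgroup Dˣ where
  carrier := {g | g ∈ SL1 K D ∧ ∃ r : ringOfIntegers p D, (g : D) - 1 = (π : D) ^ n * (r : D)}
  one_mem' := ⟨one_mem _, 0, by simp⟩
  mul_mem' := by
    rintro g h ⟨hg, r, hr⟩ ⟨hh, s, hs⟩
    refine ⟨mul_mem hg hh, r * ⟨h, mem_ringOfIntegers_of_mem_SL1 p hh⟩ + s, ?_⟩
    have : ((g * h : Dˣ) : D) - 1 = ((g : D) - 1) * h + ((h : D) - 1) := by
      rw [Units.val_mul]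
      noncomm_ring
    rw [this, hr, hs]
    push_cast
    noncomm_ring
  inv_mem' := by
    rintro g ⟨hg, r, hr⟩
    refine ⟨inv_mem hg, -r * ⟨(g⁻¹ : Dˣ), mem_ringOfIntegers_of_mem_SL1 p (inv_mem hg)⟩, ?_⟩
    have : ((g⁻¹ : Dˣ) : D) - 1 = -(((g : D) - 1) * ((g⁻¹ : Dˣ) : D)) := by
      rw [sub_mul, Units.mul_inv, one_mul, neg_sub]
    rw [this, hr]
    push_cast
    noncomm_ring

/-! ### Commutative subfields of a division algebra -/

universe u

/-! Since `ℓ` is prime, the centralizer in `D` of a non-central element `a` is the maximal subfield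
`K(a)`, hence commutative (`commute_of_commute_not_mem_range`). So a subgroup of `Dˣ` without
non-trivial central elements is CA. Conversely, a non-trivial central element forces a CA-group to
be abelian, and `SL_1^1(D)` is not (`exists_not_commute_SL1Congruence_one`). As a scalar `a` has
reduced norm `a ^ ℓ`, everything reduces to asking which `ℓ`-th roots of unity `ζ` of `K` are
congruent to `1` modulo `π ^ n`.

If `p ≠ ℓ`, then `ℓ` is a unit and only `ζ = 1` is congruent to `1` modulo `π`. If `p = ℓ`, every
`ζ` is. For `ζ ≠ 1`, `(ζ - 1) ^ (p - 1)` divides `p`, whose `π`-adic valuation is at most `eℓ`, so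
`n (p - 1) ≤ eℓ`.

For CSA, suppose `x ≠ 1` and its conjugate by `h` both centralize `g`. Then conjugation by `h`
permutes roots of the minimal polynomial of `x` in `K(x)`, so some `h ^ m` with `0 < m ≤ ℓ` commutes
with `x`. Either `h` commutes with `x`, hence with `g`, or `h ^ m = 1`, which makes `h` central by a
degree count. -/

theorem exists_field_algHom_finrank {K : Type u} {D : Type*} [Field K] [DivisionRing D]
    [Algebra K D] [FiniteDimensional K D] (x : D) :
    ∃ (F : Type u) (_ : Field F) (_ : Algebra K F) (f : F →ₐ[K] D) (y : F), f y = x ∧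
      Module.finrank K F = (minpoly K x).natDegree := by
  have hint : IsIntegral K x := Algebra.IsIntegral.isIntegral x
  have : Fact (Irreducible (minpoly K x)) := ⟨minpoly.irreducible hint⟩
  let f : AdjoinRoot (minpoly K x) →ₐ[K] D :=
    Ideal.Quotient.liftₐ (Ideal.span {minpoly K x}) (Polynomial.aeval x) (by
      intro a ha
      obtain ⟨b, rfl⟩ := Ideal.mem_span_singleton.1 ha
      rw [map_mul, minpoly.aeval, zero_mul])
  refine ⟨AdjoinRoot (minpoly K x), inferInstance, inferInstance, f, AdjoinRoot.root _, ?_, ?_⟩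
  · change Polynomial.aeval x Polynomial.X = x
    simp
  · rw [(AdjoinRoot.powerBasis (minpoly.ne_zero hint)).finrank, AdjoinRoot.powerBasis_dim]

section Division

variable {K : Type u} {D : Type*} [Field K] [DivisionRing D] [Algebra K D]

/-- `D` is a left vector space over `E`. Commutativity of `E` is not assumed, so that this applies
to centralizers. -/
theorem finrank_mul_finrank_of_algHom {E : Type*} [DivisionRing E] [Algebra K E] (f : E →ₐ[K] D) :
    ∃ k : ℕ, Module.finrank K E * k = Module.finrank K D := by
  let _ : Module E D := Module.compHom D f.toRingHom
  have : IsScalarTower K E D := ⟨fun a b d => by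
    change f (a • b) * d = a • (f b * d)
    rw [map_smul, smul_mul_assoc]⟩
  exact ⟨Module.finrank E D, Module.finrank_mul_finrank K E D⟩

theorem norm_algHom_eq_pow_finrank {F : Type*} [Field F] [Algebra K F] (f : F →ₐ[K] D) :
    ∃ k : ℕ, Module.finrank K F * k = Module.finrank K D ∧
      ∀ y : F, Algebra.norm K (f y) = Algebra.norm K y ^ k := by
  let _ : Module F D := Module.compHom D f.toRingHom
  have : IsScalarTower K F D := ⟨fun a b d => by
    change f (a • b) * d = a • (f b * d)
    rw [map_smul, smul_mul_assoc]⟩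
  refine ⟨Module.finrank F D, Module.finrank_mul_finrank K F D, fun y => ?_⟩
  have h : Algebra.lmul K D (f y)
      = ((y • LinearMap.id : D →ₗ[F] D).restrictScalars K) := by
    ext d
    rfl
  rw [Algebra.norm_apply, h, LinearMap.det_restrictScalars, LinearMap.det_smul, LinearMap.det_id,
    mul_one, map_pow]

theorem mem_range_algebraMap_of_natDegree_minpoly {x : D} (h : (minpoly K x).natDegree = 1) :
    x ∈ (algebraMap K D).range := by
  exact minpoly.natDegree_eq_one_iff.1 h

variable [Algebra.IsCentral K D]

theorem mem_range_algebraMap_of_forall_commute {x : D}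
    (h : ∀ y : D, x * y = y * x) :
    x ∈ (algebraMap K D).range := by
  obtain ⟨a, ha⟩ := (Algebra.IsCentral.mem_center_iff K).1
    (Subalgebra.mem_center_iff.2 fun b => (h b).symm)
  exact ⟨a, ha.symm⟩

variable [FiniteDimensional K D]

theorem exists_not_commute (h : 1 < Module.finrank K D) : ∃ x y : D, x * y ≠ y * x := by
  by_contra! hc
  have htop : (⊥ : Subalgebra K D) = ⊤ := by
    refine (eq_top_iff.2 fun x _ => ?_)
    exact Algebra.mem_bot.2 (mem_range_algebraMap_of_forall_commute (K := K) (hc x))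
  have := Subalgebra.bot_eq_top_iff_finrank_eq_one.1 htop
  omega

variable {ℓ : ℕ}

theorem eq_of_dvd_prime_sq (hℓ : ℓ.Prime) {m k : ℕ} (h : m * k = ℓ ^ 2) (h1 : m ≠ 1)
    (h2 : m ≠ ℓ ^ 2) : m = ℓ := by
  obtain ⟨i, hi, rfl⟩ := (Nat.dvd_prime_pow hℓ).1 ⟨k, h.symm⟩
  interval_cases i <;> simp_all

/-- The degree of `K(x)` divides `ℓ ^ 2`. It is not `1` since `x` is not a scalar, and not `ℓ ^ 2`
since `D` is not commutative. -/
theorem natDegree_minpoly_eq (hℓ : ℓ.Prime) (hD : Module.finrank K D = ℓ ^ 2) {x : D}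
    (hx : x ∉ (algebraMap K D).range) : (minpoly K x).natDegree = ℓ := by
  obtain ⟨F, _, _, f, y, rfl, hF⟩ := exists_field_algHom_finrank (K := K) x
  obtain ⟨k, hk⟩ := finrank_mul_finrank_of_algHom f
  rw [← hF]
  refine eq_of_dvd_prime_sq hℓ (hk.trans hD) ?_ ?_
  · rw [hF]
    exact fun h => hx (mem_range_algebraMap_of_natDegree_minpoly h)
  · intro h
    obtain ⟨a, b, hab⟩ := exists_not_commute (K := K) (D := D)
      (by rw [hD]; exact Nat.one_lt_pow two_ne_zero hℓ.one_lt)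
    have : FiniteDimensional K F := Module.finite_of_finrank_pos
      (by rw [h, ← hD]; exact Module.finrank_pos)
    have hs : Function.Surjective f := by
      have := (LinearMap.injective_iff_surjective_of_finrank_eq_finrank (f := f.toLinearMap)
        (h.trans hD.symm)).1 f.toRingHom.injective
      exact this
    obtain ⟨a, rfl⟩ := hs a
    obtain ⟨b, rfl⟩ := hs b
    exact hab (by rw [← map_mul, mul_comm, map_mul])

/-- A maximal subfield of `D` generated by one element is its own centralizer. -/
theorem exists_field_range_eq_centralizer (hℓ : ℓ.Prime) (hD : Module.finrank K D = ℓ ^ 2) {a : D}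
    (ha : a ∉ (algebraMap K D).range) :
    ∃ (F : Type u) (_ : Field F) (_ : Algebra K F) (f : F →ₐ[K] D),
      ∀ z : D, a * z = z * a → ∃ c : F, f c = z := by
  have hdeg := natDegree_minpoly_eq hℓ hD ha
  obtain ⟨F, _, _, f, b, rfl, hF⟩ := exists_field_algHom_finrank (K := K) a
  rw [hdeg] at hF
  set S := Subalgebra.centralizer K {f b} with hS
  have hmem : ∀ z, z ∈ S ↔ f b * z = z * f b := fun z => by
    rw [hS, Subalgebra.mem_centralizer_iff]
    simp
  have hle : f.range ≤ S := by
    rintro _ ⟨c, rfl⟩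
    rw [hmem]
    change f b * f c = f c * f b
    rw [← map_mul, mul_comm, map_mul]
  have hfr : Module.finrank K f.range = ℓ := by
    rw [← hF]
    exact (LinearEquiv.finrank_eq (AlgEquiv.ofInjective f f.toRingHom.injective).toLinearEquiv).symm
  have hSle : ℓ ≤ Module.finrank K S := by
    rw [← hfr]
    exact Submodule.finrank_mono (s := Subalgebra.toSubmodule f.range)
      (t := Subalgebra.toSubmodule S) hle
  have hSl : Module.finrank K S = ℓ := by
    -- The centralizer is a finite-dimensional domain, hence a division algebra whose dimension
    -- divides `ℓ ^ 2`. It contains `K(a)`, and it is not all of `D` because `a` is not central.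
    let _ : DivisionRing S := divisionRingOfFiniteDimensional K S
    obtain ⟨k, hk⟩ := finrank_mul_finrank_of_algHom S.val
    refine eq_of_dvd_prime_sq hℓ (hk.trans hD) ?_ ?_
    · have := hℓ.one_lt
      omega
    · intro h
      have htop : S = ⊤ := Algebra.toSubmodule_eq_top.1
        (Submodule.eq_top_of_finrank_eq (h.trans hD.symm))
      refine ha (mem_range_algebraMap_of_forall_commute fun z => ?_)
      rw [← hmem, htop]
      exact Algebra.mem_top
  have heq : f.range = S := Subalgebra.eq_of_le_of_finrank_eq hle (hfr.trans hSl.symm)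
  exact ⟨F, _, _, f, fun z hz => by rwa [← hmem, ← heq] at hz⟩

theorem commute_of_commute_not_mem_range (hℓ : ℓ.Prime) (hD : Module.finrank K D = ℓ ^ 2) {a : D}
    (ha : a ∉ (algebraMap K D).range) {x y : D} (hx : a * x = x * a) (hy : a * y = y * a) :
    x * y = y * x := by
  obtain ⟨F, _, _, f, hf⟩ := exists_field_range_eq_centralizer hℓ hD ha
  obtain ⟨c, rfl⟩ := hf x hx
  obtain ⟨d, rfl⟩ := hf y hy
  rw [← map_mul, mul_comm, map_mul]

/-- For non-central `x`, `c` is the norm of `x` from `K(x)` to `K`. This controls the ramification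
of `D` over `K`. -/
theorem exists_norm_eq_pow (hℓ : ℓ.Prime) (hD : Module.finrank K D = ℓ ^ 2) (x : D) :
    ∃ c : K, Algebra.norm K x = c ^ ℓ := by
  by_cases hx : x ∈ (algebraMap K D).range
  · obtain ⟨a, rfl⟩ := hx
    exact ⟨a ^ ℓ, by rw [Algebra.norm_algebraMap, hD, ← pow_mul, sq]⟩
  · have hdeg := natDegree_minpoly_eq hℓ hD hx
    obtain ⟨F, _, _, f, b, rfl, hF⟩ := exists_field_algHom_finrank (K := K) x
    obtain ⟨k, hk, hn⟩ := norm_algHom_eq_pow_finrank f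
    rw [hF, hdeg, hD, sq] at hk
    rw [Nat.eq_of_mul_eq_mul_left hℓ.pos hk] at hn
    exact ⟨_, hn b⟩

/-- A scalar goes to a scalar matrix, whose size is `ℓ` by comparing dimensions. -/
theorem reducedNorm_algebraMap (hD : Module.finrank K D = ℓ ^ 2) (a : K) :
    reducedNorm K D (algebraMap K D a) = algebraMap K (AlgebraicClosure K) a ^ ℓ := by
  obtain ⟨n, φ, hφ⟩ := exists_reducedNorm_eq_det K D
  have hn : n = ℓ := by
    have h := φ.toLinearEquiv.finrank_eq
    rw [Module.finrank_baseChange, hD, Module.finrank_matrix] at h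
    simp only [Fintype.card_fin, Module.finrank_self, mul_one] at h
    rw [sq] at h
    exact (Nat.mul_self_inj.1 h).symm
  subst hn
  rw [hφ]
  have : (1 : AlgebraicClosure K) ⊗ₜ[K] algebraMap K D a
      = algebraMap (AlgebraicClosure K) _ (algebraMap K (AlgebraicClosure K) a) := by
    rw [Algebra.TensorProduct.algebraMap_apply, Algebra.algebraMap_self, RingHom.id_apply,
      Algebra.algebraMap_eq_smul_one, TensorProduct.tmul_smul, TensorProduct.smul_tmul',
      Algebra.algebraMap_eq_smul_one]
  rw [this, AlgEquiv.commutes, Matrix.algebraMap_eq_diagonal, Matrix.det_diagonal]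
  simp

end Division

theorem reducedNorm_commutator (K : Type*) {D : Type*} [Field K] [DivisionRing D] [Algebra K D]
    [FiniteDimensional K D] [Algebra.IsCentral K D] (g h : Dˣ) :
    g * h * g⁻¹ * h⁻¹ ∈ SL1 K D := by
  rw [SL1, MonoidHom.mem_ker, map_mul, map_mul, map_mul, mul_right_comm, ← map_mul, ← map_mul,
    ← map_mul, mul_inv_cancel_right, mul_inv_cancel, map_one]

/-! ### The absolute value of a division algebra over `ℚ_[p]` -/

section AbsoluteValue

theorem natCast_p_ne_zero (p : ℕ) [Fact p.Prime] {D : Type*} [DivisionRing D] [Algebra ℚ_[p] D] :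
    (p : D) ≠ 0 := by
  have : CharZero D := charZero_of_injective_algebraMap (algebraMap ℚ_[p] D).injective
  exact Nat.cast_ne_zero.2 (Fact.out : p.Prime).ne_zero

variable (p : ℕ) [Fact p.Prime] (D : Type*) [DivisionRing D] [Algebra ℚ_[p] D]
  [FiniteDimensional ℚ_[p] D]

/-- The multiplicative map `x ↦ ‖N(x)‖` on a division algebra of finite dimension over `ℚ_[p]`. -/
noncomputable def absNorm : D →*₀ ℝ where
  toFun x := ‖Algebra.norm ℚ_[p] x‖
  map_zero' := by rw [Algebra.norm_zero, norm_zero]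
  map_one' := by rw [map_one, norm_one]
  map_mul' x y := by rw [map_mul, norm_mul]

variable {D}

theorem absNorm_nonneg (x : D) : 0 ≤ absNorm p D x := norm_nonneg (Algebra.norm ℚ_[p] x)

theorem absNorm_pos {x : D} (hx : x ≠ 0) : 0 < absNorm p D x :=
  lt_of_le_of_ne (absNorm_nonneg p x) (Ne.symm ((map_ne_zero _).2 hx))

theorem mem_ringOfIntegers_iff (x : D) : x ∈ ringOfIntegers p D ↔ absNorm p D x ≤ 1 :=
  isIntegral_iff_norm_norm_le_one p x

theorem absNorm_neg (x : D) : absNorm p D (-x) = absNorm p D x := by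
  have h : absNorm p D (-1) ^ 2 = 1 := by rw [← map_pow]; simp
  rw [pow_eq_one_iff_of_nonneg (absNorm_nonneg p _) two_ne_zero] at h
  rw [← neg_one_mul, map_mul, h, one_mul]

/-- Dividing by the larger term `y` reduces the claim to `x * y⁻¹ + 1` being integral, which holds
because the integers form a ring. -/
theorem absNorm_add_le_max (x y : D) :
    absNorm p D (x + y) ≤ max (absNorm p D x) (absNorm p D y) := by
  wlog h : absNorm p D x ≤ absNorm p D y generalizing x y
  · rw [add_comm, max_comm]
    exact this y x (le_of_not_ge h)
  rw [max_eq_right h]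
  rcases eq_or_ne y 0 with rfl | hy
  · rw [map_zero] at h
    have : x = 0 := (map_eq_zero _).1 (le_antisymm h (absNorm_nonneg p x))
    simp [this]
  have h1 : x * y⁻¹ ∈ ringOfIntegers p D := by
    rw [mem_ringOfIntegers_iff, map_mul, map_inv₀, ← div_eq_mul_inv]
    exact div_le_one_of_le₀ h (absNorm_nonneg p y)
  have h2 := (mem_ringOfIntegers_iff p _).1 (add_mem h1 (one_mem _))
  calc absNorm p D (x + y) = absNorm p D (x * y⁻¹ + 1) * absNorm p D y := by
        rw [← map_mul, add_mul, inv_mul_cancel_right₀ hy, one_mul]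
    _ ≤ absNorm p D y := mul_le_of_le_one_left (absNorm_nonneg p y) h2

theorem absNorm_sub_le_max (x y : D) :
    absNorm p D (x - y) ≤ max (absNorm p D x) (absNorm p D y) := by
  rw [sub_eq_add_neg, ← absNorm_neg p y]
  exact absNorm_add_le_max p x (-y)

theorem absNorm_eq_one_of_sub_one_lt {x : D} (h : absNorm p D (x - 1) < 1) :
    absNorm p D x = 1 := by
  apply le_antisymm
  · have := absNorm_add_le_max p (x - 1) 1
    rw [sub_add_cancel, map_one] at this
    exact this.trans (max_le h.le le_rfl)
  · by_contra! hx
    have := absNorm_sub_le_max p x (x - 1)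
    rw [sub_sub_cancel, map_one] at this
    exact absurd this (not_le.2 (max_lt hx h))

theorem absNorm_conj {h : D} (hh : h ≠ 0) (x : D) :
    absNorm p D (h * x * h⁻¹) = absNorm p D x := by
  rw [map_mul, map_mul, map_inv₀, mul_comm,
    inv_mul_cancel_left₀ ((map_ne_zero _).2 hh)]

theorem absNorm_natCast (n : ℕ) :
    absNorm p D n = ‖(n : ℚ_[p])‖ ^ Module.finrank ℚ_[p] D := by
  change ‖Algebra.norm ℚ_[p] (n : D)‖ = _
  rw [← map_natCast (algebraMap ℚ_[p] D), Algebra.norm_algebraMap, norm_pow]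

theorem absNorm_p_lt_one : absNorm p D p < 1 := by
  rw [absNorm_natCast]
  exact pow_lt_one₀ (norm_nonneg _) Padic.norm_p_lt_one Module.finrank_pos.ne'

theorem absNorm_algebraMap {K : Type*} [Field K] [Algebra ℚ_[p] K] [FiniteDimensional ℚ_[p] K]
    [Algebra K D] [IsScalarTower ℚ_[p] K D] (a : K) :
    absNorm p D (algebraMap K D a) = absNorm p K a ^ Module.finrank K D := by
  change ‖Algebra.norm ℚ_[p] (algebraMap K D a)‖ = _
  rw [← Algebra.norm_norm (S := K), Algebra.norm_algebraMap, map_pow, norm_pow]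
  rfl

/-! ### Generators of the maximal ideal and congruence subgroups -/

variable {p}

theorem absNorm_lt_one_of_generatesMaximalIdeal {π : ringOfIntegers p D}
    (hπ : GeneratesMaximalIdeal p π) : absNorm p D π < 1 := by
  refine lt_of_le_of_ne ((mem_ringOfIntegers_iff p _).1 π.2) fun h => hπ.ne_top ?_
  have h0 : (π : D) ≠ 0 := fun h0 => by simp [h0] at h
  have hinv : (π : D)⁻¹ ∈ ringOfIntegers p D := by
    rw [mem_ringOfIntegers_iff, map_inv₀, h, inv_one]
  rw [Ideal.eq_top_iff_one]
  refine Ideal.mem_span_singleton'.2 ⟨⟨_, hinv⟩, Subtype.ext ?_⟩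
  exact inv_mul_cancel₀ h0

/-- The elements of `absNorm` less than `1` form a proper left ideal containing `π`, so by
maximality they are the multiples of `π`. -/
theorem absNorm_le_of_generatesMaximalIdeal {π : ringOfIntegers p D}
    (hπ : GeneratesMaximalIdeal p π) {d : D} (hd : absNorm p D d < 1) :
    absNorm p D d ≤ absNorm p D π := by
  let I : Ideal (ringOfIntegers p D) :=
    { carrier := {x | absNorm p D x < 1}
      zero_mem' := by simp
      add_mem' := fun {x y} hx hy => (absNorm_add_le_max p (x : D) y).trans_lt (max_lt hx hy)
      smul_mem' := fun c x hx => by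
        change absNorm p D ((c : D) * x) < 1
        rw [map_mul]
        exact mul_lt_one_of_nonneg_of_lt_one_right ((mem_ringOfIntegers_iff p _).1 c.2)
          (absNorm_nonneg p _) hx }
  have hI : I ≠ ⊤ := by
    rw [Ideal.ne_top_iff_one]
    change ¬ absNorm p D (1 : D) < 1
    simp
  have hle : Ideal.span {π} ≤ I :=
    (Ideal.span_singleton_le_iff_mem I).2 (absNorm_lt_one_of_generatesMaximalIdeal hπ)
  have hdI : (⟨d, (mem_ringOfIntegers_iff p d).2 hd.le⟩ : ringOfIntegers p D) ∈ I := hd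
  rw [← hπ.eq_of_le hI hle] at hdI
  obtain ⟨r, hr⟩ := Ideal.mem_span_singleton'.1 hdI
  have hr' : (r : D) * π = d := congrArg Subtype.val hr
  rw [← hr', map_mul]
  exact mul_le_of_le_one_left (absNorm_nonneg p _) ((mem_ringOfIntegers_iff p _).1 r.2)

theorem ne_zero_of_generatesMaximalIdeal {π : ringOfIntegers p D}
    (hπ : GeneratesMaximalIdeal p π) : (π : D) ≠ 0 := by
  intro h
  have := absNorm_le_of_generatesMaximalIdeal hπ (absNorm_p_lt_one p (D := D))
  rw [h, map_zero] at this
  exact absurd (absNorm_pos p (natCast_p_ne_zero p (D := D))) (not_lt.2 this)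

theorem mem_SL1Congruence_iff {K : Type*} [Field K]
    [Algebra ℚ_[p] K] [Algebra K D] [IsScalarTower ℚ_[p] K D]
    [Algebra.IsCentral K D] [FiniteDimensional K D] {π : ringOfIntegers p D}
    (hπ : GeneratesMaximalIdeal p π) (n : ℕ) (g : Dˣ) :
    g ∈ SL1Congruence p K π n ↔
      g ∈ SL1 K D ∧ absNorm p D ((g : D) - 1) ≤ absNorm p D π ^ n := by
  refine and_congr_right fun _ => ⟨?_, fun h => ?_⟩
  · rintro ⟨r, hr⟩
    rw [hr, map_mul, map_pow]
    exact mul_le_of_le_one_right (pow_nonneg (absNorm_nonneg p _) _)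
      ((mem_ringOfIntegers_iff p _).1 r.2)
  · have h0 : (π : D) ^ n ≠ 0 := pow_ne_zero _ (ne_zero_of_generatesMaximalIdeal hπ)
    refine ⟨⟨((π : D) ^ n)⁻¹ * ((g : D) - 1), ?_⟩, (mul_inv_cancel_left₀ h0 _).symm⟩
    rw [mem_ringOfIntegers_iff, map_mul, map_inv₀, map_pow, inv_mul_eq_div]
    exact div_le_one_of_le₀ h (pow_nonneg (absNorm_nonneg p _) _)

theorem mem_SL1Congruence_one_iff {K : Type*} [Field K]
    [Algebra ℚ_[p] K] [Algebra K D] [IsScalarTower ℚ_[p] K D]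
    [Algebra.IsCentral K D] [FiniteDimensional K D] {π : ringOfIntegers p D}
    (hπ : GeneratesMaximalIdeal p π) (g : Dˣ) :
    g ∈ SL1Congruence p K π 1 ↔ g ∈ SL1 K D ∧ absNorm p D ((g : D) - 1) < 1 := by
  rw [mem_SL1Congruence_iff hπ, pow_one]
  exact and_congr_right fun _ =>
    ⟨fun h => h.trans_lt (absNorm_lt_one_of_generatesMaximalIdeal hπ),
      absNorm_le_of_generatesMaximalIdeal hπ⟩

end AbsoluteValue

/-! ### Roots of unity -/

section RootsOfUnity

variable {p : ℕ} [Fact p.Prime] {K : Type*} [Field K] [Algebra ℚ_[p] K] [FiniteDimensional ℚ_[p] K]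
  {ℓ : ℕ} {ζ : K}

/-- `ℓ` is the product of the `1 - ζ ^ i` for `0 < i < ℓ`, each divisible by `ζ - 1` in `ℤ[ζ]`,
whose elements are integral. -/
theorem absNorm_natCast_le_pow (hℓ : ℓ.Prime) (hζ : ζ ^ ℓ = 1) (h1 : ζ ≠ 1) :
    absNorm p K ℓ ≤ absNorm p K (ζ - 1) ^ (ℓ - 1) := by
  have : Fact ℓ.Prime := ⟨hℓ⟩
  have hprim : IsPrimitiveRoot ζ ℓ := orderOf_eq_prime hζ h1 ▸ IsPrimitiveRoot.orderOf ζ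
  obtain ⟨z, hz, h⟩ := hprim.self_sub_one_pow_dvd_order (Nat.sub_lt hℓ.pos one_pos)
  have hζi : ζ ∈ ringOfIntegers p K := by
    rw [mem_ringOfIntegers_iff, (pow_eq_one_iff_of_nonneg (absNorm_nonneg p _) hℓ.ne_zero).1
      (by rw [← map_pow, hζ, map_one] : absNorm p K ζ ^ ℓ = 1)]
  have hzi : z ∈ ringOfIntegers p K := by
    have : Algebra.adjoin ℤ {ζ} ≤ subalgebraOfSubring (ringOfIntegers p K) :=
      Algebra.adjoin_le (by simpa using hζi)
    exact this hz
  rw [h, map_mul, map_pow]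
  exact mul_le_of_le_one_left (pow_nonneg (absNorm_nonneg p _) _)
    ((mem_ringOfIntegers_iff p _).1 hzi)

theorem eq_one_of_absNorm_sub_one_lt (hℓ : ℓ.Prime) (hp : p ≠ ℓ) (hζ : ζ ^ ℓ = 1)
    (h : absNorm p K (ζ - 1) < 1) : ζ = 1 := by
  by_contra h1
  have h2 := absNorm_natCast_le_pow (p := p) hℓ hζ h1
  have h3 : ‖(ℓ : ℚ_[p])‖ = 1 := by
    rw [Padic.norm_natCast_eq_one_iff]
    exact (Nat.coprime_primes Fact.out hℓ).2 hp
  rw [absNorm_natCast, h3, one_pow] at h2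
  exact absurd (pow_lt_one₀ (absNorm_nonneg p _) h (Nat.sub_pos_of_lt hℓ.one_lt).ne') (not_lt.2 h2)

/-- Modulo `p`, `(ζ - 1) ^ p` equals `ζ ^ p - 1 = 0`. -/
theorem absNorm_sub_one_lt_one (hζ : ζ ^ p = 1) : absNorm p K (ζ - 1) < 1 := by
  have hp : p.Prime := Fact.out
  have hζi : absNorm p K ζ ≤ 1 := by
    rw [(pow_eq_one_iff_of_nonneg (absNorm_nonneg p _) hp.ne_zero).1
      (by rw [← map_pow, hζ, map_one] : absNorm p K ζ ^ p = 1)]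
  let y : integralClosure (PadicInt.subring p) K :=
    ⟨ζ - 1, (mem_ringOfIntegers_iff p _).2 ((absNorm_sub_le_max p ζ 1).trans (by simp [hζi]))⟩
  obtain ⟨r, hr⟩ := exists_add_pow_prime_eq hp y 1
  have hr' : ζ ^ p = (ζ - 1) ^ p + 1 + p * ((ζ - 1) * r) := by
    have := congrArg Subtype.val hr
    simpa [y, mul_assoc] using this
  have h : (ζ - 1) ^ p = - (p * ((ζ - 1) * r)) := by
    rw [hζ] at hr'
    linear_combination - hr'
  have hy : absNorm p K (ζ - 1) ≤ 1 := (mem_ringOfIntegers_iff p _).1 y.2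
  have hr1 : absNorm p K r ≤ 1 := (mem_ringOfIntegers_iff p _).1 r.2
  have h2 : absNorm p K (ζ - 1) ^ p < 1 := by
    rw [← map_pow, h, absNorm_neg, map_mul, map_mul]
    exact mul_lt_one_of_nonneg_of_lt_one_left (absNorm_nonneg p _) (absNorm_p_lt_one p)
      (mul_le_one₀ hy (absNorm_nonneg p _) hr1)
  exact (pow_lt_one_iff_of_nonneg (absNorm_nonneg p _) hp.ne_zero).1 h2

end RootsOfUnity

/-! ### The ramification index -/

section Ramification

variable (p : ℕ) [Fact p.Prime] (K : Type*) [Field K] [Algebra ℚ_[p] K] [FiniteDimensional ℚ_[p] K]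

/-- The nonzero values of `absNorm` below `1` have the form `p ^ (-n)` with `n` natural, so an
element with least `n` works. -/
theorem exists_uniformizer : ∃ ϖ : K, ϖ ≠ 0 ∧ absNorm p K ϖ < 1 ∧
    ∀ x : K, absNorm p K x < 1 → absNorm p K x ≤ absNorm p K ϖ := by
  have hp1 : (1 : ℝ) < p := by exact_mod_cast (Fact.out : p.Prime).one_lt
  have hval : ∀ x : K, x ≠ 0 → absNorm p K x < 1 →
      ∃ n : ℕ, absNorm p K x = (p : ℝ) ^ (-(n : ℤ)) := by
    intro x hx h
    have hN : Algebra.norm ℚ_[p] x ≠ 0 := Algebra.norm_ne_zero_iff.2 hx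
    have hw : absNorm p K x = (p : ℝ) ^ (-(Algebra.norm ℚ_[p] x).valuation) :=
      Padic.norm_eq_zpow_neg_valuation hN
    have hv : 0 ≤ (Algebra.norm ℚ_[p] x).valuation := by
      rw [hw] at h
      by_contra! hneg
      exact absurd (one_lt_zpow₀ hp1 (neg_pos.2 hneg)) (not_lt.2 h.le)
    obtain ⟨n, hn⟩ := Int.eq_ofNat_of_zero_le hv
    exact ⟨n, by rw [hw, hn]⟩
  have hex : ∃ n : ℕ, ∃ x : K, x ≠ 0 ∧ absNorm p K x < 1 ∧
      absNorm p K x = (p : ℝ) ^ (-(n : ℤ)) := by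
    obtain ⟨n, hn⟩ := hval p (natCast_p_ne_zero p) (absNorm_p_lt_one p)
    exact ⟨n, p, natCast_p_ne_zero p, absNorm_p_lt_one p, hn⟩
  classical
  obtain ⟨ϖ, h0, h1, hϖ⟩ := Nat.find_spec hex
  refine ⟨ϖ, h0, h1, fun x hx => ?_⟩
  rcases eq_or_ne x 0 with rfl | hx0
  · rw [map_zero]
    exact absNorm_nonneg p _
  obtain ⟨n, hn⟩ := hval x hx0 hx
  rw [hn, hϖ]
  have := Nat.find_min' hex ⟨x, hx0, hx, hn⟩
  exact zpow_le_zpow_right₀ hp1.le (by omega)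

theorem mem_integralClosure_iff_absNorm_le_one (x : K) :
    x ∈ integralClosure (PadicInt.subring p) K ↔ absNorm p K x ≤ 1 :=
  mem_ringOfIntegers_iff p x

theorem isDedekindDomain_integralClosure_padic :
    IsDedekindDomain (integralClosure (PadicInt.subring p) K) := by
  have : IsFractionRing (PadicInt.subring p) ℚ_[p] :=
    inferInstanceAs (IsFractionRing ℤ_[p] ℚ_[p])
  have : IsDedekindDomain (PadicInt.subring p) := inferInstanceAs (IsDedekindDomain ℤ_[p])
  exact integralClosure.isDedekindDomain (PadicInt.subring p) ℚ_[p] K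

theorem isMaximal_span_natCast_padic : (Ideal.span {(p : PadicInt.subring p)}).IsMaximal := by
  have h : (Ideal.span {(p : ℤ_[p])}).IsMaximal :=
    PadicInt.maximalIdeal_eq_span_p (p := p) ▸ IsLocalRing.maximalIdeal.isMaximal _
  exact h

/-- The index `e` is the multiplicity in `(p)` of the prime `P = (ϖ)`. If `p` were smaller than `ϖ ^
e`, the quotient `p / ϖ ^ e` would be a multiple of `ϖ`, and `P ^ (e + 1)` would divide `(p)`. -/
theorem ramificationIndex_pos_and_absNorm_pow_le {ϖ : K} (h0 : ϖ ≠ 0) (h1 : absNorm p K ϖ < 1)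
    (hϖ : ∀ x : K, absNorm p K x < 1 → absNorm p K x ≤ absNorm p K ϖ) :
    0 < ramificationIndex p K ∧ absNorm p K ϖ ^ ramificationIndex p K ≤ absNorm p K p := by
  set B := integralClosure (PadicInt.subring p) K with hB
  have : IsDedekindDomain B := isDedekindDomain_integralClosure_padic p K
  have hmax := isMaximal_span_natCast_padic p
  have hfs : FaithfulSMul (PadicInt.subring p) B := by
    refine (faithfulSMul_iff_algebraMap_injective _ _).2 fun x y hxy => Subtype.ext ?_
    exact (algebraMap ℚ_[p] K).injective (congrArg Subtype.val hxy)
  -- `ramificationIdxIn` refers to a chosen prime above `p`, with a default value if there is none;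
  -- the proof must use that same choice.
  have hex : ∃ P : Ideal B, P.IsPrime ∧ P.LiesOver (Ideal.span {(p : PadicInt.subring p)}) := by
    obtain ⟨Q, hQ, hQ'⟩ := Ideal.exists_maximal_ideal_liesOver_of_isIntegral (S := B)
      (Ideal.span {(p : PadicInt.subring p)})
    exact ⟨Q, hQ.isPrime, hQ'⟩
  have he : ramificationIndex p K = hex.choose.ramificationIdx (PadicInt.subring p) := by
    rw [ramificationIndex, Ideal.ramificationIdxIn, dif_pos hex]
  obtain ⟨hP, hPo⟩ := hex.choose_spec
  set P := hex.choose
  have hmap : (Ideal.span {(p : PadicInt.subring p)}).map (algebraMap (PadicInt.subring p) B)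
      = Ideal.span {(p : B)} := by
    rw [Ideal.map_span, Set.image_singleton, map_natCast]
  have hp0 : (p : B) ≠ 0 := fun h => natCast_p_ne_zero p (D := K) (congrArg Subtype.val h)
  have hspan : Ideal.span {(p : B)} ≠ ⊥ := by simpa using hp0
  have hmul : ramificationIndex p K = multiplicity P (Ideal.span {(p : B)}) := by
    rw [he, Ideal.IsDedekindDomain.ramificationIdx_eq_multiplicity
      (Ideal.span {(p : PadicInt.subring p)}) P (by rwa [hmap]), hmap]
  have hpP : (p : B) ∈ P := by
    have := (Ideal.mem_of_liesOver P (Ideal.span {(p : PadicInt.subring p)}) p).1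
      (Ideal.mem_span_singleton_self _)
    rwa [map_natCast] at this
  have hP0 : P ≠ ⊥ := fun h => hp0 (by rwa [h, Ideal.mem_bot] at hpP)
  have hfin : FiniteMultiplicity P (Ideal.span {(p : B)}) :=
    FiniteMultiplicity.of_prime_left (Ideal.prime_of_isPrime hP0 hP) hspan
  -- `B` is a valuation ring: divisibility can be read off from `absNorm`.
  have hdvd : ∀ x y : B, y ≠ 0 → absNorm p K x ≤ absNorm p K y → y ∣ x := by
    intro x y hy hxy
    have hy' : (y : K) ≠ 0 := fun h => hy (Subtype.ext h)
    refine ⟨⟨(y : K)⁻¹ * x, ?_⟩, Subtype.ext (mul_inv_cancel_left₀ hy' _).symm⟩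
    rw [mem_integralClosure_iff_absNorm_le_one, map_mul, map_inv₀, inv_mul_eq_div]
    exact div_le_one_of_le₀ hxy (absNorm_nonneg p _)
  let ϖB : B := ⟨ϖ, (mem_integralClosure_iff_absNorm_le_one p K ϖ).2 h1.le⟩
  have hϖB : ϖB ≠ 0 := fun h => h0 (congrArg Subtype.val h)
  have hPϖ : P = Ideal.span {ϖB} := by
    apply le_antisymm
    · intro x hx
      rw [Ideal.mem_span_singleton]
      refine hdvd x ϖB hϖB (hϖ _ (lt_of_not_ge fun hge => ?_))
      refine hP.ne_top ((Ideal.eq_top_iff_one _).2 ?_)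
      have hx0 : x ≠ 0 := by
        rintro rfl
        simp at hge
        linarith
      obtain ⟨c, hc⟩ := hdvd 1 x hx0 (by simpa using hge)
      rw [hc]
      exact P.mul_mem_right _ hx
    · rw [Ideal.span_singleton_le_iff_mem]
      obtain ⟨k, hk⟩ := exists_pow_lt_of_lt_one (absNorm_pos p (natCast_p_ne_zero p (D := K))) h1
      have : (p : B) ∣ ϖB ^ k := hdvd _ _ hp0 (by
        change absNorm p K (ϖ ^ k) ≤ absNorm p K (p : K)
        rw [map_pow]
        exact hk.le)
      exact hP.mem_of_pow_mem k (P.mem_of_dvd this hpP)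
  constructor
  · rw [hmul]
    refine (hfin.pow_dvd_iff_le_multiplicity (k := 1)).1 ?_
    rwa [pow_one, Ideal.dvd_span_singleton]
  · by_contra! hlt
    refine hfin.not_pow_dvd_of_multiplicity_lt (m := ramificationIndex p K + 1) (by omega) ?_
    rw [Ideal.dvd_span_singleton, hPϖ, Ideal.span_singleton_pow, Ideal.mem_span_singleton]
    refine hdvd _ _ (pow_ne_zero _ hϖB) ?_
    change absNorm p K (p : K) ≤ absNorm p K (ϖ ^ _)
    have hpos : 0 < absNorm p K ϖ ^ ramificationIndex p K := pow_pos (absNorm_pos p h0) _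
    have := hϖ ((p : K) * (ϖ ^ ramificationIndex p K)⁻¹) (by
      rw [map_mul, map_inv₀, map_pow, ← div_eq_mul_inv]
      exact (div_lt_one hpos).2 hlt)
    rw [map_mul, map_inv₀, map_pow, ← div_eq_mul_inv, div_le_iff₀ hpos] at this
    rwa [map_pow, pow_succ']

theorem ramificationIndex_pos : 0 < ramificationIndex p K := by
  obtain ⟨ϖ, h0, h1, hϖ⟩ := exists_uniformizer p K
  exact (ramificationIndex_pos_and_absNorm_pow_le p K h0 h1 hϖ).1

/-- Applied to `π`, this bounds the `π`-adic valuation of `p` by `eℓ`. The value of `x` is the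
`ℓ`-th power of the value of some `c` in `K`, which is at most that of `ϖ`, while the value of `p`
gets raised to the power `ℓ ^ 2` from `K` to `D`. -/
theorem absNorm_pow_ramificationIndex_le {D : Type*} [DivisionRing D] [Algebra ℚ_[p] D]
    [Algebra K D] [IsScalarTower ℚ_[p] K D] [FiniteDimensional ℚ_[p] D] [FiniteDimensional K D]
    [Algebra.IsCentral K D] {ℓ : ℕ} (hℓ : ℓ.Prime) (hD : Module.finrank K D = ℓ ^ 2) {x : D}
    (hx : absNorm p D x < 1) :
    absNorm p D x ^ (ramificationIndex p K * ℓ) ≤ absNorm p D p := by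
  obtain ⟨ϖ, h0, h1, hϖ⟩ := exists_uniformizer p K
  have he := (ramificationIndex_pos_and_absNorm_pow_le p K h0 h1 hϖ).2
  obtain ⟨c, hc⟩ := exists_norm_eq_pow (K := K) hℓ hD x
  have hxc : absNorm p D x = absNorm p K c ^ ℓ := by
    change ‖Algebra.norm ℚ_[p] x‖ = _
    rw [← Algebra.norm_norm (S := K), hc, map_pow, norm_pow]
    rfl
  rw [hxc, pow_lt_one_iff_of_nonneg (absNorm_nonneg p _) hℓ.ne_zero] at hx
  have hp : absNorm p D p = absNorm p K p ^ ℓ ^ 2 := by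
    rw [← hD, ← absNorm_algebraMap, map_natCast (algebraMap K D)]
  rw [hxc, hp, ← pow_mul]
  calc absNorm p K c ^ (ℓ * (ramificationIndex p K * ℓ))
      ≤ absNorm p K ϖ ^ (ℓ * (ramificationIndex p K * ℓ)) :=
        pow_le_pow_left₀ (absNorm_nonneg p _) (hϖ c hx) _
    _ = (absNorm p K ϖ ^ ramificationIndex p K) ^ ℓ ^ 2 := by
        rw [← pow_mul]
        ring_nf
    _ ≤ _ := pow_le_pow_left₀ (pow_nonneg (absNorm_nonneg p _) _) he _

end Ramification

/-! ### Abelian normal subgroups of the multiplicative group of a division ring -/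

/-- A Cartan–Brauer–Hua type argument. The conjugates `a`, `b` of `g` by `d` and `1 + d` commute
with `g` and satisfy `(b - a) * d = g - b`. If `b ≠ a`, then `d` is a quotient of elements commuting
with `g`; otherwise `a = g`, that is, `d` commutes with `g`. -/
theorem commute_of_normal_of_commute {D : Type*} [DivisionRing D] (N : Subgroup Dˣ)
    (hN : N.Normal) (hc : ∀ x ∈ N, ∀ y ∈ N, x * y = y * x) {g : Dˣ} (hg : g ∈ N) (d : D) :
    (g : D) * d = d * g := by
  by_contra hd
  have hd0 : d ≠ 0 := fun h => hd (by simp [h])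
  have hd1 : 1 + d ≠ 0 := fun h => hd (by
    rw [← neg_eq_of_add_eq_zero_right h]
    simp)
  have h1 := hN.conj_mem g hg (Units.mk0 d hd0)
  have h2 := hN.conj_mem g hg (Units.mk0 (1 + d) hd1)
  set a := Units.mk0 d hd0 * g * (Units.mk0 d hd0)⁻¹ with ha
  set b := Units.mk0 (1 + d) hd1 * g * (Units.mk0 (1 + d) hd1)⁻¹ with hb
  have had : (a : D) * d = d * g := by
    have : a * Units.mk0 d hd0 = Units.mk0 d hd0 * g := by rw [ha, inv_mul_cancel_right]
    exact congrArg Units.val this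
  have hbd : (b : D) * (1 + d) = (1 + d) * g := by
    have : b * Units.mk0 (1 + d) hd1 = Units.mk0 (1 + d) hd1 * g := by
      rw [hb, inv_mul_cancel_right]
    exact congrArg Units.val this
  have hga : (g : D) * a = a * g := congrArg Units.val (hc _ hg _ h1)
  have hgb : (g : D) * b = b * g := congrArg Units.val (hc _ hg _ h2)
  have key : ((b : D) - a) * d = g - b := by
    rw [sub_mul, had]
    rw [mul_add, mul_one, add_mul, one_mul] at hbd
    rw [sub_eq_sub_iff_add_eq_add, add_comm, hbd]
  have hcomm : ((b : D) - a) * (g * d) = ((b : D) - a) * (d * g) := by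
    calc ((b : D) - a) * (g * d) = g * (((b : D) - a) * d) := by
          rw [← mul_assoc, ← mul_assoc, mul_sub, sub_mul, hga, hgb]
      _ = (((b : D) - a) * d) * g := by rw [key, mul_sub, sub_mul, hgb]
      _ = _ := mul_assoc _ _ _
  rcases eq_or_ne ((b : D) - a) 0 with h | h
  · rw [h, zero_mul, eq_comm, sub_eq_zero] at key
    rw [← sub_eq_zero.1 h, ← key] at had
    exact hd had
  · exact hd (mul_left_cancel₀ h hcomm)

/-! ### The congruence subgroup of level one is not abelian -/

section NotAbelian

variable {p : ℕ} [Fact p.Prime] {K D : Type*} [Field K] [Algebra ℚ_[p] K] [DivisionRing D]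
  [Algebra ℚ_[p] D] [Algebra K D] [IsScalarTower ℚ_[p] K D] [FiniteDimensional ℚ_[p] D]
  [FiniteDimensional K D] [Algebra.IsCentral K D] {π : ringOfIntegers p D}

theorem normal_SL1Congruence_one (hπ : GeneratesMaximalIdeal p π) :
    (SL1Congruence p K π 1).Normal := by
  refine ⟨fun g hg h => ?_⟩
  rw [mem_SL1Congruence_one_iff hπ] at hg ⊢
  have hn : (SL1 K D).Normal := MonoidHom.normal_ker _
  refine ⟨hn.conj_mem g hg.1 h, ?_⟩
  have : ((h * g * h⁻¹ : Dˣ) : D) - 1 = h * ((g : D) - 1) * (h : D)⁻¹ := by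
    rw [mul_sub, mul_one, sub_mul, mul_inv_cancel₀ h.ne_zero]
    simp
  rw [this, absNorm_conj p h.ne_zero]
  exact hg.2

theorem commutator_mem_SL1Congruence_one (hπ : GeneratesMaximalIdeal p π) {g h : Dˣ}
    (hg : absNorm p D ((g : D) - 1) < 1) (hh : absNorm p D ((h : D) - 1) < 1) :
    g * h * g⁻¹ * h⁻¹ ∈ SL1Congruence p K π 1 := by
  rw [mem_SL1Congruence_one_iff hπ]
  refine ⟨reducedNorm_commutator K g h, ?_⟩
  have hgh : ((g * h * g⁻¹ * h⁻¹ : Dˣ) : D) - 1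
      = (((g : D) - 1) * ((h : D) - 1) - ((h : D) - 1) * ((g : D) - 1)) *
        ((g : D)⁻¹ * (h : D)⁻¹) := by
    have h1 : (h : D) * g * ((g : D)⁻¹ * (h : D)⁻¹) = 1 := by
      rw [mul_assoc, mul_inv_cancel_left₀ g.ne_zero, mul_inv_cancel₀ h.ne_zero]
    have h2 : ((g : D) - 1) * ((h : D) - 1) - ((h : D) - 1) * ((g : D) - 1)
      = (g : D) * h - h * g := by noncomm_ring
    rw [h2, sub_mul, h1]
    simp [mul_assoc]
  rw [hgh, map_mul, map_mul, map_inv₀, map_inv₀, absNorm_eq_one_of_sub_one_lt p hg,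
    absNorm_eq_one_of_sub_one_lt p hh, inv_one, mul_one, mul_one]
  refine (absNorm_sub_le_max p _ _).trans_lt (max_lt ?_ ?_) <;> rw [map_mul]
  · exact mul_lt_one_of_nonneg_of_lt_one_left (absNorm_nonneg p _) hg hh.le
  · exact mul_lt_one_of_nonneg_of_lt_one_left (absNorm_nonneg p _) hh hg.le

/-- If this normal subgroup of `Dˣ` were abelian, it would be central, and so would be all
commutators of principal units. Comparing the commutators of `y` with `1 + a` and with `1 + p * a`
shows that `y` commutes with `a`, and rescaling by powers of `p` makes `D` commutative. -/
theorem exists_not_commute_SL1Congruence_one (hπ : GeneratesMaximalIdeal p π)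
    (hD : 1 < Module.finrank K D) :
    ∃ x ∈ SL1Congruence p K π 1, ∃ y ∈ SL1Congruence p K π 1, x * y ≠ y * x := by
  by_contra! hc
  have hcen := fun (g : Dˣ) (hg : g ∈ SL1Congruence p K π 1) =>
    commute_of_normal_of_commute _ (normal_SL1Congruence_one hπ) hc hg
  have hπ1 := absNorm_lt_one_of_generatesMaximalIdeal hπ
  have hp1 := absNorm_p_lt_one p (D := D)
  have hp0 := natCast_p_ne_zero p (D := D)
  have hunit : ∀ a : D, absNorm p D a < 1 → ∃ u : Dˣ, (u : D) = 1 + a := fun a ha => by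
    refine ⟨Units.mk0 (1 + a) fun h => ?_, rfl⟩
    rw [← neg_eq_of_add_eq_zero_right h, absNorm_neg, map_one] at ha
    exact lt_irrefl _ ha
  -- conjugation multiplies principal units by central elements
  have hconj : ∀ y : Dˣ, absNorm p D ((y : D) - 1) < 1 → ∀ a : D, absNorm p D a < 1 →
      ∃ z : D, (∀ d, z * d = d * z) ∧ y * (1 + a) = z * ((1 + a) * y) := fun y hy a ha => by
    obtain ⟨u, hu⟩ := hunit a ha
    have hmem := commutator_mem_SL1Congruence_one (K := K) hπ hy (h := u)
      (by rwa [hu, add_sub_cancel_left])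
    refine ⟨_, hcen _ hmem, ?_⟩
    rw [← hu, ← Units.val_mul, ← Units.val_mul, ← Units.val_mul]
    congr 1
    group
  have hsmall : ∀ y : Dˣ, absNorm p D ((y : D) - 1) < 1 → ∀ a : D, absNorm p D a < 1 →
      y * a = a * y := fun y hy a ha => by
    by_contra hne
    have hpa : absNorm p D (p * a) < 1 := by
      rw [map_mul]
      exact mul_lt_one_of_nonneg_of_lt_one_left (absNorm_nonneg p _) hp1 ha.le
    obtain ⟨z, hz, h1⟩ := hconj y hy a ha
    obtain ⟨t, ht, h2⟩ := hconj y hy _ hpa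
    have hpc : ∀ d : D, (p : D) * d = d * p := fun d => Nat.cast_comm p d
    -- put everything in the form `r + s * a = 0` with `r`, `s` central
    have h3 : ((p : D) * (z - 1) - (t - 1)) + (p : D) * (z - t) * a = 0 := by
      refine (mul_eq_zero.1 ?_).resolve_right y.ne_zero
      have e1 : (p : D) * (y * (1 + a)) = p * (z * ((1 + a) * y)) := by rw [h1]
      have e2 : (y : D) * (p * a) = p * (y * a) := by
        rw [← mul_assoc, ← hpc, mul_assoc]
      have e3 : (t : D) * (p * (a * y)) = p * (t * (a * y)) := by
        rw [← mul_assoc, ht, mul_assoc]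
      have e4 : (y : D) + p * (y * a) = t * y + p * (t * (a * y)) := by
        rw [← e2, ← e3]
        simpa [mul_add, add_mul, mul_assoc] using h2
      have e5 : (p : D) * y + p * (y * a) = p * (z * y) + p * (z * (a * y)) := by
        simpa [mul_add, add_mul, mul_assoc] using e1
      have e6 : (((p : D) * (z - 1) - (t - 1)) + (p : D) * (z - t) * a) * y
          = (p * (z * y) + p * (z * (a * y))) - (t * y + p * (t * (a * y))) - p * y + y := by
        noncomm_ring
      rw [e6, ← e5, ← e4]
      abel
    -- Otherwise `h3` writes `a` as a quotient of central elements, so `a` commutes with `y`.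
    have hzt : z = t := by
      by_contra hzt
      have h4 : (p : D) * (z - t) ≠ 0 := mul_ne_zero hp0 (sub_ne_zero.2 hzt)
      have hya : (p : D) * (z - t) * (y * a) = (p : D) * (z - t) * (a * y) := by
        have hs : (p : D) * (z - t) * a = -((p : D) * (z - 1) - (t - 1)) :=
          eq_neg_of_add_eq_zero_right h3
        have hcs : (y : D) * ((p : D) * (z - t)) = (p : D) * (z - t) * y := by
          rw [← mul_assoc, ← hpc, mul_assoc, mul_assoc, mul_sub, sub_mul, hz, ht]
        rw [← mul_assoc, ← hcs, mul_assoc, ← mul_assoc _ a, hs, mul_neg, neg_mul, mul_sub, sub_mul,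
          ← mul_assoc, ← hpc, mul_assoc, mul_assoc, mul_sub, sub_mul, hz, mul_sub, sub_mul, ht]
        noncomm_ring
      exact hne (mul_left_cancel₀ h4 hya)
    rw [← hzt, sub_self, mul_zero, zero_mul, add_zero] at h3
    have h5 : ((p : D) - 1) * (z - 1) = 0 := by rw [sub_mul, one_mul, h3]
    have hp1' : (p : D) - 1 ≠ 0 := fun h => by
      rw [sub_eq_zero.1 h, map_one] at hp1
      exact lt_irrefl _ hp1
    rw [sub_eq_zero.1 ((mul_eq_zero.1 h5).resolve_left hp1'), one_mul] at h1
    exact hne (by simpa [mul_add, add_mul] using h1)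
  obtain ⟨x, y, hxy⟩ := exists_not_commute hD
  -- Powers of the central element `p` bring any element into the maximal ideal without affecting
  -- commutation.
  have hscale : ∀ x : D, ∃ k : ℕ, absNorm p D ((p : D) ^ k * x) < 1 := fun x => by
    rcases eq_or_ne x 0 with rfl | hx
    · exact ⟨0, by simp⟩
    obtain ⟨k, hk⟩ := exists_pow_lt_of_lt_one (inv_pos.2 (absNorm_pos p hx)) hp1
    refine ⟨k, ?_⟩
    rw [map_mul, map_pow]
    have := mul_lt_mul_of_pos_right hk (absNorm_pos p hx)
    rwa [inv_mul_cancel₀ (absNorm_pos p hx).ne'] at this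
  obtain ⟨k, hk⟩ := hscale x
  obtain ⟨m, hm⟩ := hscale y
  obtain ⟨u, hu⟩ := hunit _ hm
  have h := hsmall u (by rwa [hu, add_sub_cancel_left]) _ hk
  rw [hu, add_mul, mul_add, one_mul, mul_one, add_right_inj] at h
  have hpk : ∀ (k : ℕ) (d : D), (p : D) ^ k * d = d * (p : D) ^ k := fun k d => by
    rw [← Nat.cast_pow, Nat.cast_comm]
  rw [mul_assoc, ← mul_assoc y, ← hpk, mul_assoc _ y, mul_assoc, ← mul_assoc x, ← hpk, mul_assoc _ x,
    ← mul_assoc, ← mul_assoc _ _ (x * y), hpk m] at h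
  exact hxy (mul_left_cancel₀ (mul_ne_zero (pow_ne_zero _ hp0) (pow_ne_zero _ hp0)) h).symm

end NotAbelian

/-! ### The CA and CSA properties of subgroups of `SL_1(D)` -/

section CA

variable {K D : Type*} [Field K] [DivisionRing D] [Algebra K D] [FiniteDimensional K D]
  [Algebra.IsCentral K D] {ℓ : ℕ}

/-- The obstruction to CA: the centralizer of a central element is the whole group. -/
theorem commute_of_isCA {G : Type*} [Group G] {H : Subgroup G} (hH : IsCA H) {z : G} (hz : z ∈ H)
    (hz1 : z ≠ 1) (hzc : ∀ x ∈ H, z * x = x * z) {x y : G} (hx : x ∈ H) (hy : y ∈ H) :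
    x * y = y * x := by
  have hmem : ∀ (w : G) (hw : w ∈ H), (⟨w, hw⟩ : H) ∈ Subgroup.centralizer {(⟨z, hz⟩ : H)} := by
    intro w hw
    rw [Subgroup.mem_centralizer_singleton_iff]
    exact Subtype.ext (hzc w hw).symm
  exact congrArg Subtype.val (hH ⟨z, hz⟩ (fun h => hz1 (congrArg Subtype.val h))
    ⟨x, hx⟩ (hmem x hx) ⟨y, hy⟩ (hmem y hy))

theorem isCA_of_forall_not_mem_range (hℓ : ℓ.Prime) (hD : Module.finrank K D = ℓ ^ 2)
    (H : Subgroup Dˣ) (hH : ∀ g ∈ H, (g : D) ∈ (algebraMap K D).range → g = 1) : IsCA H := by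
  intro g hg x hx y hy
  rw [Subgroup.mem_centralizer_singleton_iff] at hx hy
  have hgr : ((g : Dˣ) : D) ∉ (algebraMap K D).range := fun h => hg (Subtype.ext (hH g g.2 h))
  have hv : ∀ {a b : H}, a * b = b * a → ((b : Dˣ) : D) * (a : Dˣ) = (a : Dˣ) * (b : Dˣ) :=
    fun h => congrArg (fun u : H => ((u : Dˣ) : D)) h.symm
  exact Subtype.ext (Units.ext (commute_of_commute_not_mem_range hℓ hD hgr (hv hx) (hv hy)))

theorem pow_eq_one_of_algebraMap_mem_SL1 (hD : Module.finrank K D = ℓ ^ 2) {g : Dˣ}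
    (hg : g ∈ SL1 K D) {a : K} (ha : algebraMap K D a = g) : a ^ ℓ = 1 := by
  have h : reducedNorm K D (g : D) = 1 := hg
  rw [← ha, reducedNorm_algebraMap hD, ← map_pow] at h
  exact (algebraMap K (AlgebraicClosure K)).injective (by rw [h, map_one])

theorem exists_unit_mem_SL1 (hℓ : ℓ.Prime) (hD : Module.finrank K D = ℓ ^ 2) {ζ : K}
    (hζ : ζ ^ ℓ = 1) : ∃ g : Dˣ, (g : D) = algebraMap K D ζ ∧ g ∈ SL1 K D := by
  have h0 : algebraMap K D ζ ≠ 0 := by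
    rw [Ne, map_eq_zero]
    rintro rfl
    rw [zero_pow hℓ.ne_zero] at hζ
    exact zero_ne_one hζ
  refine ⟨Units.mk0 _ h0, rfl, ?_⟩
  change reducedNorm K D (algebraMap K D ζ) = 1
  rw [reducedNorm_algebraMap hD, ← map_pow, hζ, map_one]

theorem eq_one_of_mem_SL1_of_mem_range (hD : Module.finrank K D = ℓ ^ 2)
    (hK : ∀ ζ : K, ζ ^ ℓ = 1 → ζ = 1) {g : Dˣ} (hg : g ∈ SL1 K D)
    (hr : (g : D) ∈ (algebraMap K D).range) : g = 1 := by
  obtain ⟨a, ha⟩ := hr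
  have := hK a (pow_eq_one_of_algebraMap_mem_SL1 hD hg ha)
  exact Units.ext (by rw [← ha, this, map_one, Units.val_one])

/-- The iterated conjugates of `x` by `h` all lie in the field `K(x)` and are roots of the minimal
polynomial of `x`. It has at most `ℓ` roots there, so two of the first `ℓ + 1` conjugates coincide.
-/
theorem exists_pow_commute_of_conj (hℓ : ℓ.Prime) (hD : Module.finrank K D = ℓ ^ 2) {x h : D}
    (hx : x ∉ (algebraMap K D).range) (hh : h ≠ 0)
    (hxh : x * (h * x * h⁻¹) = h * x * h⁻¹ * x) :
    ∃ m : ℕ, 0 < m ∧ m ≤ ℓ ∧ x * h ^ m = h ^ m * x := by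
  let φ : D →ₐ[K] D :=
    { toFun s := h * s * h⁻¹
      map_one' := by rw [mul_one, mul_inv_cancel₀ hh]
      map_mul' s t := by
        rw [mul_assoc (h * s), ← mul_assoc h⁻¹, ← mul_assoc h⁻¹, inv_mul_cancel₀ hh, one_mul,
          ← mul_assoc, ← mul_assoc]
      map_zero' := by rw [mul_zero, zero_mul]
      map_add' s t := by rw [mul_add, add_mul]
      commutes' a := by rw [← Algebra.commutes, mul_assoc, mul_inv_cancel₀ hh, mul_one] }
  have hφ : ∀ s, φ s * h = h * s := fun s => inv_mul_cancel_right₀ hh _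
  have hφx : φ x ∉ (algebraMap K D).range := by
    rintro ⟨a, ha⟩
    exact hx ⟨a, φ.toRingHom.injective ((φ.commutes a).trans ha)⟩
  have hiter : ∀ i : ℕ, φ^[i] x * h ^ i = h ^ i * x := by
    intro i
    induction i with
    | zero => simp
    | succ i ih => rw [Function.iterate_succ_apply', pow_succ', ← mul_assoc, hφ, mul_assoc, ih,
        mul_assoc]
  have hcomm : ∀ i : ℕ, x * φ^[i] x = φ^[i] x * x := by
    intro i
    induction i with
    | zero => rfl
    | succ i ih =>
      rw [Function.iterate_succ_apply']
      -- Both `x` and the next iterate lie in the centralizer of `φ x`, which is commutative.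
      exact commute_of_commute_not_mem_range hℓ hD hφx hxh.symm (by rw [← map_mul, ih, map_mul])
  obtain ⟨F, _, _, f, hf⟩ := exists_field_range_eq_centralizer hℓ hD hx
  choose y hy using fun i : ℕ => hf _ (hcomm i)
  set q := minpoly K x
  have hq0 : q ≠ 0 := minpoly.ne_zero (Algebra.IsIntegral.isIntegral x)
  have hroot : ∀ i : ℕ, Polynomial.aeval (φ^[i] x) q = 0 := by
    intro i
    induction i with
    | zero => exact minpoly.aeval K x
    | succ i ih => rw [Function.iterate_succ_apply', Polynomial.aeval_algHom_apply, ih, map_zero]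
  classical
  have hyroot : ∀ i : ℕ, y i ∈ (q.aroots F).toFinset := by
    intro i
    rw [Multiset.mem_toFinset, Polynomial.mem_aroots]
    refine ⟨hq0, f.toRingHom.injective ?_⟩
    change f _ = f 0
    rw [← Polynomial.aeval_algHom_apply, hy, hroot, map_zero]
  have hcard : (q.aroots F).toFinset.card ≤ ℓ := by
    rw [← natDegree_minpoly_eq hℓ hD hx]
    exact (Multiset.toFinset_card_le _).trans
      ((Polynomial.card_roots' _).trans Polynomial.natDegree_map_le)
  obtain ⟨i, hi, j, hj, hij, hyij⟩ := Finset.exists_ne_map_eq_of_card_lt_of_maps_to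
    (s := Finset.range (ℓ + 1)) (by rw [Finset.card_range]; omega) (fun i _ => hyroot i)
  have key : ∀ i j : ℕ, i < j → j ≤ ℓ → y i = y j → ∃ m : ℕ, 0 < m ∧ m ≤ ℓ ∧
      x * h ^ m = h ^ m * x := by
    intro i j hij hj hyij
    have hxij : φ^[i] x = φ^[j] x := by rw [← hy, ← hy, hyij]
    obtain ⟨m, rfl⟩ := Nat.exists_eq_add_of_lt hij
    refine ⟨m + 1, by omega, by omega, mul_left_cancel₀ (pow_ne_zero i hh) ?_⟩
    have := hiter (i + m + 1)
    rwa [← hxij, add_assoc, pow_add, ← mul_assoc, hiter, mul_assoc, mul_assoc] at this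
  rw [Finset.mem_range] at hi hj
  rcases lt_or_gt_of_ne hij with h | h
  · exact key i j h (by omega) hyij
  · exact key j i h (by omega) hyij.symm

/-- If `h ≠ 1`, it is a root of `1 + X + ⋯ + X ^ (m - 1)`, whose degree is below the degree `ℓ` of a
non-central element. -/
theorem mem_range_of_pow_eq_one (hℓ : ℓ.Prime) (hD : Module.finrank K D = ℓ ^ 2) {h : D} {m : ℕ}
    (hm : 0 < m) (hmℓ : m ≤ ℓ) (h1 : h ^ m = 1) : h ∈ (algebraMap K D).range := by
  by_contra hr
  have hdeg := natDegree_minpoly_eq hℓ hD hr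
  have hne : h ≠ 1 := fun h => hr ⟨1, by rw [h, map_one]⟩
  let P : Polynomial K := ∑ i ∈ Finset.range m, Polynomial.X ^ i
  have hP : Polynomial.aeval h P = 0 := by
    have : (∑ i ∈ Finset.range m, h ^ i) * (h - 1) = 0 := by rw [geom_sum_mul, h1, sub_self]
    simpa [P] using (mul_eq_zero.1 this).resolve_right (sub_ne_zero.2 hne)
  have hPm : P.Monic := Polynomial.monic_geom_sum_X hm.ne'
  have h2 := Polynomial.natDegree_le_of_dvd (minpoly.dvd K h hP) hPm.ne_zero
  have h3 : P.natDegree ≤ m - 1 := Polynomial.natDegree_sum_le_of_forall_le _ _ fun i hi => by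
    rw [Polynomial.natDegree_X_pow]
    have := Finset.mem_range.1 hi
    omega
  omega

theorem isCSA_SL1 (hℓ : ℓ.Prime) (hD : Module.finrank K D = ℓ ^ 2)
    (hK : ∀ ζ : K, ζ ^ ℓ = 1 → ζ = 1) : IsCSA (SL1 K D) := by
  refine ⟨isCA_of_forall_not_mem_range hℓ hD _ fun g hg => eq_one_of_mem_SL1_of_mem_range hD hK hg,
    fun g h hh x hx hxh => ?_⟩
  rw [Subgroup.mem_centralizer_singleton_iff] at hh hx hxh
  have hv : ∀ {a b : SL1 K D}, a * b = b * a →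
      ((b : Dˣ) : D) * (a : Dˣ) = (a : Dˣ) * (b : Dˣ) :=
    fun h => congrArg (fun u : SL1 K D => ((u : Dˣ) : D)) h.symm
  by_contra hx1
  have hnr : ∀ {u : SL1 K D}, u ≠ 1 → ((u : Dˣ) : D) ∉ (algebraMap K D).range := fun {u} hu hr =>
    hu (Subtype.ext (eq_one_of_mem_SL1_of_mem_range hD hK u.2 hr))
  have hg1 : g ≠ 1 := by
    rintro rfl
    exact hh (by simp)
  -- `h` does not commute with `x`, as centralizers are abelian
  have hhx : ((x : Dˣ) : D) * (h : Dˣ) ≠ (h : Dˣ) * (x : Dˣ) := fun hc => by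
    have := commute_of_commute_not_mem_range hℓ hD (hnr hx1) (hv hx).symm hc
    exact hh (Subtype.ext (Units.ext this.symm))
  have hcc := commute_of_commute_not_mem_range hℓ hD (hnr hg1) (hv hx) (hv hxh)
  have hval : (((h * x * h⁻¹ : SL1 K D) : Dˣ) : D)
      = ((h : Dˣ) : D) * (x : Dˣ) * ((h : Dˣ) : D)⁻¹ := by simp
  rw [hval] at hcc
  obtain ⟨m, hm, hmℓ, hpow⟩ := exists_pow_commute_of_conj hℓ hD (hnr hx1) (h : Dˣ).ne_zero hcc
  -- A non-trivial `h ^ m` would be non-central, and `x` and `h` would both lie in its commutative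
  -- centralizer.
  have hpow1 : h ^ m = 1 := by
    by_contra hne
    have hnr' := hnr hne
    refine hhx (commute_of_commute_not_mem_range hℓ hD hnr' ?_ ?_)
    · simpa using hpow.symm
    · simpa using (pow_mul_comm' ((h : Dˣ) : D) m)
  have hh1 : h ≠ 1 := by
    rintro rfl
    exact hhx (by simp)
  refine hnr hh1 (mem_range_of_pow_eq_one hℓ hD hm hmℓ ?_)
  simpa using congrArg (fun u : SL1 K D => ((u : Dˣ) : D)) hpow1

end CA

theorem theoremt (p : ℕ) [Fact p.Prime] (ℓ : ℕ) (hℓ : ℓ.Prime)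
    (K : Type*) [Field K] [Algebra ℚ_[p] K] [FiniteDimensional ℚ_[p] K]
    (D : Type*) [DivisionRing D] [Algebra ℚ_[p] D] [Algebra K D] [IsScalarTower ℚ_[p] K D]
    [FiniteDimensional ℚ_[p] D] [FiniteDimensional K D] [Algebra.IsCentral K D]
    (hD : Module.finrank K D = ℓ ^ 2)
    (π : ringOfIntegers p D) (hπ : GeneratesMaximalIdeal p π) :
    ((IsCA (SL1 K D) ↔ ∀ ζ : K, ζ ^ ℓ = 1 → ζ = 1) ∧
      ((∀ ζ : K, ζ ^ ℓ = 1 → ζ = 1) → IsCSA (SL1 K D))) ∧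
    (IsCA (SL1Congruence p K π 1) ↔
      p ≠ ℓ ∨ (p = ℓ ∧ ∀ ζ : K, ζ ^ ℓ = 1 → ζ = 1)) ∧
    (∀ n : ℕ, (ramificationIndex p K : ℝ) * ℓ / ((p : ℝ) - 1) ≤ n →
      (p = ℓ → (∃ ζ : K, ζ ^ ℓ = 1 ∧ ζ ≠ 1) →
        (ramificationIndex p K : ℝ) * ℓ / ((p : ℝ) - 1) < n) →
      IsCA (SL1Congruence p K π n)) := by
  have hD1 : 1 < Module.finrank K D := by
    rw [hD]
    exact Nat.one_lt_pow two_ne_zero hℓ.one_lt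
  obtain ⟨x, hx, y, hy, hxy⟩ := exists_not_commute_SL1Congruence_one (K := K) hπ hD1
  have hπ0 := ne_zero_of_generatesMaximalIdeal hπ
  have hπ1 := absNorm_lt_one_of_generatesMaximalIdeal hπ
  have hcentral : ∀ {ζ : K} {g : Dˣ}, (g : D) = algebraMap K D ζ → ∀ z : Dˣ, g * z = z * g :=
    fun hg z => Units.ext (by
      rw [Units.val_mul, Units.val_mul, hg]
      exact Algebra.commutes _ _)
  have hne : ∀ {ζ : K} {g : Dˣ}, (g : D) = algebraMap K D ζ → ζ ≠ 1 → g ≠ 1 := by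
    rintro ζ _ hg h1 rfl
    exact h1 ((algebraMap K D).injective (by rw [← hg, map_one, Units.val_one]))
  have hsub : ∀ a : K, absNorm p D (algebraMap K D a - 1) = absNorm p K (a - 1) ^ ℓ ^ 2 := by
    intro a
    rw [← hD, ← absNorm_algebraMap, map_sub (algebraMap K D), map_one]
  have hℓ2 : ℓ ^ 2 ≠ 0 := pow_ne_zero _ hℓ.ne_zero
  have hlt : ∀ a : K, absNorm p D (algebraMap K D a - 1) < 1 ↔ absNorm p K (a - 1) < 1 := by
    intro a
    rw [hsub, pow_lt_one_iff_of_nonneg (absNorm_nonneg p _) hℓ2]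
  refine ⟨⟨⟨fun hCA ζ hζ => ?_, fun hK => (isCSA_SL1 hℓ hD hK).1⟩, isCSA_SL1 hℓ hD⟩,
    ⟨fun hCA => ?_, fun h => ?_⟩, fun n hn hn' => ?_⟩
  · by_contra h1
    obtain ⟨g, hg, hgS⟩ := exists_unit_mem_SL1 hℓ hD hζ
    exact hxy (commute_of_isCA hCA hgS (hne hg h1) (fun z _ => hcentral hg z) hx.1 hy.1)
  · refine (ne_or_eq p ℓ).imp_right fun hpℓ => ⟨hpℓ, fun ζ hζ => ?_⟩
    by_contra h1
    obtain ⟨g, hg, hgS⟩ := exists_unit_mem_SL1 hℓ hD hζ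
    have hgm : g ∈ SL1Congruence p K π 1 := by
      rw [mem_SL1Congruence_one_iff hπ, hg, hlt]
      exact ⟨hgS, absNorm_sub_one_lt_one (hpℓ ▸ hζ)⟩
    exact hxy (commute_of_isCA hCA hgm (hne hg h1) (fun z _ => hcentral hg z) hx hy)
  · refine isCA_of_forall_not_mem_range hℓ hD _ fun g hg hr => ?_
    rcases h with hpℓ | ⟨-, hK⟩
    · obtain ⟨a, ha⟩ := hr
      rw [mem_SL1Congruence_one_iff hπ, ← ha, hlt] at hg
      have := eq_one_of_absNorm_sub_one_lt hℓ hpℓ (pow_eq_one_of_algebraMap_mem_SL1 hD hg.1 ha) hg.2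
      exact Units.ext (by rw [← ha, this, map_one, Units.val_one])
    · exact eq_one_of_mem_SL1_of_mem_range hD hK hg.1 hr
  · have hp1 : (0 : ℝ) < (p : ℝ) - 1 := by
      have : (1 : ℝ) < p := by exact_mod_cast (Fact.out : p.Prime).one_lt
      linarith
    -- The bound is positive because `e` is; for `p ≠ ℓ` nothing more than `n ≥ 1` is needed.
    have hn0 : n ≠ 0 := by
      rintro rfl
      have he : (0 : ℝ) < ramificationIndex p K := by exact_mod_cast ramificationIndex_pos p K
      have hℓ0 : (0 : ℝ) < ℓ := by exact_mod_cast hℓ.pos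
      have : 0 < (ramificationIndex p K : ℝ) * ℓ / ((p : ℝ) - 1) := by positivity
      rw [Nat.cast_zero] at hn
      linarith
    refine isCA_of_forall_not_mem_range hℓ hD _ fun g hg hr => ?_
    obtain ⟨a, ha⟩ := hr
    rw [mem_SL1Congruence_iff hπ, ← ha] at hg
    have haℓ := pow_eq_one_of_algebraMap_mem_SL1 hD hg.1 ha
    suffices a = 1 from Units.ext (by rw [← ha, this, map_one, Units.val_one])
    by_cases hpℓ : p = ℓ
    · by_contra ha1
      -- The supposed central element `a ≠ 1` is itself the root of unity that makes the inequality
      -- strict.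
      have hstrict := hn' hpℓ ⟨a, haℓ, ha1⟩
      have h1 := absNorm_pow_ramificationIndex_le p K hℓ hD hπ1
      have h2 : absNorm p D p ≤ absNorm p D π ^ (n * (p - 1)) := by
        have h3 := absNorm_natCast_le_pow (p := p) hℓ haℓ ha1
        rw [← hpℓ] at h3
        calc absNorm p D p = absNorm p K p ^ ℓ ^ 2 := by
              rw [← hD, ← absNorm_algebraMap, map_natCast (algebraMap K D)]
          _ ≤ (absNorm p K (a - 1) ^ (p - 1)) ^ ℓ ^ 2 :=
              pow_le_pow_left₀ (absNorm_nonneg p _) h3 _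
          _ = absNorm p D (algebraMap K D a - 1) ^ (p - 1) := by
              rw [hsub, ← pow_mul, ← pow_mul, mul_comm]
          _ ≤ (absNorm p D π ^ n) ^ (p - 1) := pow_le_pow_left₀ (absNorm_nonneg p _) hg.2 _
          _ = _ := (pow_mul _ _ _).symm
      -- The base is less than `1`, so exponents compare in reverse: `n (p - 1) ≤ eℓ`, against
      -- `hstrict`.
      have h4 := (pow_le_pow_iff_right_of_lt_one₀ (absNorm_pos p hπ0) hπ1).1 (h1.trans h2)
      rw [div_lt_iff₀ hp1] at hstrict
      have h5 : ((n * (p - 1) : ℕ) : ℝ) ≤ ((ramificationIndex p K * ℓ : ℕ) : ℝ) := by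
        exact_mod_cast h4
      rw [Nat.cast_mul, Nat.cast_mul, Nat.cast_sub (Fact.out : p.Prime).one_lt.le,
        Nat.cast_one] at h5
      linarith
    · refine eq_one_of_absNorm_sub_one_lt hℓ hpℓ haℓ ((hlt a).1 ?_)
      exact hg.2.trans_lt (pow_lt_one₀ (absNorm_nonneg p _) hπ1 hn0)
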